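/- Let $n\in\mathbb N$. Let $\mathcal F(\mathbb C^{n\times n})$ be the space of holomorphic functions on $\mathbb C^{n\times n}$ that are square integrable with respect to $\pi^{-n^2}e^{-\operatorname{Tr}(z^*z)}dz$, with inner product $\langle F,G\rangle=\pi^{-n^2}\int \overline{F(z)}G(z)e^{-\operatorname{Tr}(z^*z)}dz$, and let $\mathcal F(\mathbb C^{n\times n})^U$ be the subspace of those $F$ with $F(z)=F(u^{-1}zu)$ for all $u$ in the unitary group $U=U(n)$. Let $\mathcal F(\mathbb C^n)$ be the space of holomorphic functions on $\mathbb C^n$ that are square integrable with respect to $\pi^{-n}e^{-|z|^2}dz$, with inner product $\langle F,G\rangle=\pi^{-n}\int\overline{F(z)}G(z)e^{-|z|^2}dz$, and let $\mathcal F(\mathbb C^n)_{\mathrm{alt}}$ be the subspace of those $F$ with $F(z_1,\dots,z_n)=\operatorname{sgn}(\sigma)F(z_{\sigma^{-1}(1)},\dots,z_{\sigma^{-1}(n)})$ for all $\sigma\in S_n$. Identify $x\in\mathbb C^n$ with the diagonal matrix with diagonal $x$, and put $\Delta(x)=\prod_{i<j}(x_j-x_i)$ and $c=\left(\prod_{p=1}^n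 p!\right)^{-1/2}$. Let $du$ be the Haar probability measure on $U$, and let $$Q_a(z)=\int_U e^{\operatorname{Tr}(u^{-1}zua^*)}\,du\quad(a,z\in\mathbb C^{n\times n}),\qquad R_a(z)=\frac1{n!}\sum_{\sigma\in S_n}\operatorname{sgn}(\sigma)\,e^{\sum_i z_{\sigma^{-1}(i)}\overline{a_i}}\quad(a,z\in\mathbb C^n)$$ be the coherent states of $\mathcal F(\mathbb C^{n\times n})^U$ and $\mathcal F(\mathbb C^n)_{\mathrm{alt}}$. Then the following are equivalent: 1. the Harish-Chandra–Itzykson–Zuber integral formula for $n\times n$ matrices: for all real $a_1<\dots<a_n$ and $b_1<\dots<b_n$, with $A=\operatorname{diag}(a_1,\dots,a_n)$ and $B=\operatorname{diag}(b_1,\dots,b_n)$, $$\int_U e^{\operatorname{Tr}(uAu^{-1}B)}\,du=\left(\prod_{p=1}^{n-1}p!\right)\frac{\det\left[e^{a_ib_j}\right]_{i,j=1}^n}{\Delta(a)\Delta(b)};$$ 2. the map $\psi:\mathcal F(\mathbb C^{n\times n})^U\to\mathcal F(\mathbb C^n)_{\mathrm{alt}}$, $\psi(F)(x)=c\,\Delta(x)\,F(x)$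 for diagonal $x$, is well defined (that is, $\psi(F)\in\mathcal F(\mathbb C^n)_{\mathrm{alt}}$ for all $F\in\mathcal F(\mathbb C^{n\times n})^U$) and unitary (a linear bijection that preserves inner products). Moreover, in this case, for every diagonal $x$ with distinct entries, $Q_x\in\mathcal F(\mathbb C^{n\times n})^U$ and $$\psi(Q_x)=\frac{R_x}{c\,\Delta(\overline x)}.$$ -/

import Mathlib

open MeasureTheory Matrix
open scoped ComplexConjugate Nat

noncomputable section

namespace SegalBargmann

/-- The Segal-Bargmann space on `ℂ^ι`: the entire functions on `ℂ^ι` that are square integrable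
against the Gaussian weight `exp (-|z|²)`. -/
def space (ι : Type) [Fintype ι] : Submodule ℂ ((ι → ℂ) → ℂ) where
  carrier := {F | Differentiable ℂ F ∧
    Integrable (fun z : ι → ℂ => ‖F z‖ ^ 2 * Real.exp (-∑ i, ‖z i‖ ^ 2)) volume}
  zero_mem' := ⟨differentiable_const 0, by simp⟩
  add_mem' := by
    rintro F G ⟨hF, hF'⟩ ⟨hG, hG'⟩
    refine ⟨hF.add hG, ((hF'.add hG').const_mul 2).mono' ?_ (.of_forall fun z => ?_)⟩
    · have h1 := hF.continuous
      have h2 := hG.continuous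
      have h3 : Continuous (fun z => F z + G z) := h1.add h2
      have h4 : Continuous (fun z : ι → ℂ => Real.exp (-∑ i, ‖z i‖ ^ 2)) := by fun_prop
      exact ((h3.norm.pow 2).mul h4).aestronglyMeasurable
    · have hE := Real.exp_pos (-∑ i, ‖z i‖ ^ 2)
      rw [Real.norm_of_nonneg (by positivity)]
      simp only [Pi.add_apply]
      have h1 : ‖F z + G z‖ ^ 2 ≤ 2 * (‖F z‖ ^ 2 + ‖G z‖ ^ 2) := by
        have := norm_add_le (F z) (G z)
        nlinarith [norm_nonneg (F z + G z), sq_nonneg (‖F z‖ - ‖G z‖)]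
      nlinarith
  smul_mem' := by
    rintro a F ⟨hF, hF'⟩
    refine ⟨hF.const_smul a, ?_⟩
    simpa [mul_pow, mul_assoc] using hF'.const_mul (‖a‖ ^ 2)

/-- The Gaussian inner product `⟨F, G⟩ = π^{-|ι|} ∫ conj (F z) G z exp (-|z|²) dz`, where `dz` is
Lebesgue measure on `ℂ^ι`. The integral converges absolutely for `F` and `G` in `space ι`. -/
def innerProd {ι : Type} [Fintype ι] (F G : (ι → ℂ) → ℂ) : ℂ :=
  ((Real.pi : ℂ) ^ Fintype.card ι)⁻¹ *
    ∫ z : ι → ℂ, conj (F z) * G z * (Real.exp (-∑ i, ‖z i‖ ^ 2) : ℂ)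

/-- The `n × n` matrix whose entries are the coordinates of a vector indexed by `n × n`. -/
def toMat {n : ℕ} (z : Fin n × Fin n → ℂ) : Matrix (Fin n) (Fin n) ℂ :=
  Matrix.of fun i j => z (i, j)

/-- In the coordinates given by the entries, `|z|² = Tr (z* z)`. -/
theorem trace_toMat {n : ℕ} (z : Fin n × Fin n → ℂ) :
    ((toMat z)ᴴ * toMat z).trace = ((∑ i, ‖z i‖ ^ 2 : ℝ) : ℂ) := by
  simp only [Matrix.trace, Matrix.diag, Matrix.mul_apply, Matrix.conjTranspose_apply, toMat,
    Matrix.of_apply, Fintype.sum_prod_type]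
  rw [Finset.sum_comm]
  push_cast
  refine Finset.sum_congr rfl fun i _ => Finset.sum_congr rfl fun j _ => ?_
  simpa using Complex.conj_mul' (z (i, j))

/-- The unitary group `U`, with its Borel σ-algebra. -/
abbrev U (n : ℕ) := Matrix.unitaryGroup (Fin n) ℂ

instance (n : ℕ) : MeasurableSpace (U n) := borel _

instance (n : ℕ) : BorelSpace (U n) := ⟨rfl⟩

instance (n : ℕ) : CompactSpace (U n) := by
  refine isCompact_iff_compactSpace.mp (?_ : IsCompact
    ((Matrix.unitaryGroup (Fin n) ℂ : Submonoid (Matrix (Fin n) (Fin n) ℂ)) :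
      Set (Matrix (Fin n) (Fin n) ℂ)))
  have hK : IsCompact (Set.pi Set.univ fun _ : Fin n => Set.pi Set.univ fun _ : Fin n =>
      Metric.closedBall (0 : ℂ) 1) :=
    isCompact_univ_pi fun _ => isCompact_univ_pi fun _ => isCompact_closedBall 0 1
  refine IsCompact.of_isClosed_subset (X := Matrix (Fin n) (Fin n) ℂ) hK
    (isClosed_unitary (R := Matrix (Fin n) (Fin n) ℂ)) ?_
  intro u hu i _ j _
  simpa using entry_norm_bound_of_unitary hu i j

/-- The Haar probability measure on the unitary group. -/
def haarU (n : ℕ) : Measure (U n) := Measure.haarMeasure ⊤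

theorem haarU_univ (n : ℕ) : haarU n Set.univ = 1 := Measure.haarMeasure_self

/-- `F(ℂ^{n×n})^U`: the functions of the Segal-Bargmann space on `ℂ^{n×n}` that are invariant
under conjugation by all unitary matrices. -/
def invSpace (n : ℕ) : Submodule ℂ (Matrix (Fin n) (Fin n) ℂ → ℂ) where
  carrier := {F | (fun z => F (toMat z)) ∈ space (Fin n × Fin n) ∧
    ∀ (u : U n) (z : Matrix (Fin n) (Fin n) ℂ), F z = F ((u⁻¹ : U n).1 * z * u.1)}
  zero_mem' := ⟨(space (Fin n × Fin n)).zero_mem, fun _ _ => rfl⟩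
  add_mem' := fun hF hG => ⟨(space (Fin n × Fin n)).add_mem hF.1 hG.1, fun u z => by
    simp only [Pi.add_apply]; rw [hF.2 u z, hG.2 u z]⟩
  smul_mem' := fun a F hF => ⟨(space (Fin n × Fin n)).smul_mem a hF.1, fun u z => by
    simp only [Pi.smul_apply]; rw [hF.2 u z]⟩

/-- The inner product of the Segal-Bargmann space on `ℂ^{n×n}`. -/
def innerMat {n : ℕ} (F G : Matrix (Fin n) (Fin n) ℂ → ℂ) : ℂ :=
  innerProd (fun z => F (toMat z)) (fun z => G (toMat z))

/-- `F(ℂ^n)_alt`: the alternating functions of the Segal-Bargmann space on `ℂ^n`. -/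
def altSpace (n : ℕ) : Submodule ℂ ((Fin n → ℂ) → ℂ) where
  carrier := {F | F ∈ space (Fin n) ∧ ∀ (σ : Equiv.Perm (Fin n)) (z : Fin n → ℂ),
    F z = ((Equiv.Perm.sign σ : ℤ) : ℂ) * F (fun i => z (σ⁻¹ i))}
  zero_mem' := ⟨(space (Fin n)).zero_mem, fun _ _ => by simp⟩
  add_mem' := fun hF hG => ⟨(space (Fin n)).add_mem hF.1 hG.1, fun σ z => by
    simp only [Pi.add_apply]; rw [hF.2 σ z, hG.2 σ z, mul_add]⟩
  smul_mem' := fun a F hF => ⟨(space (Fin n)).smul_mem a hF.1, fun σ z => by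
    simp only [Pi.smul_apply, smul_eq_mul]; rw [hF.2 σ z, mul_left_comm]⟩

/-- The coherent state `K_a(z) = exp (Tr (z a*))` of the Segal-Bargmann space on `ℂ^{n×n}`. -/
def cohMat {n : ℕ} (a z : Matrix (Fin n) (Fin n) ℂ) : ℂ := Complex.exp ((z * aᴴ).trace)

/-- The coherent state `Q_a = P K_a` of `F(ℂ^{n×n})^U`, where the projection `P` is averaging over
the unitary group, `P F (z) = ∫ F (u⁻¹ z u) du`. -/
def Q {n : ℕ} (a z : Matrix (Fin n) (Fin n) ℂ) : ℂ :=
  ∫ u : U n, cohMat a ((u⁻¹ : U n).1 * z * u.1) ∂(haarU n)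

/-- The coherent state `K_a(z) = exp (z · conj a)` of the Segal-Bargmann space on `ℂ^n`. -/
def coh {n : ℕ} (a z : Fin n → ℂ) : ℂ := Complex.exp (∑ i, z i * conj (a i))

/-- The coherent state `R_a = P K_a` of `F(ℂ^n)_alt`, where the projection `P` is
antisymmetrization. -/
def R {n : ℕ} (a z : Fin n → ℂ) : ℂ :=
  (n ! : ℂ)⁻¹ * ∑ σ : Equiv.Perm (Fin n),
    ((Equiv.Perm.sign σ : ℤ) : ℂ) * coh a (fun i => z (σ⁻¹ i))

/-- The Vandermonde determinant `Δ(x) = ∏_{i<j} (x_j - x_i)`. -/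
def vdm {n : ℕ} (x : Fin n → ℂ) : ℂ := ∏ i, ∏ j ∈ Finset.Ioi i, (x j - x i)

/-- The constant `c = (∏_{p=1}^n p!)^{-1/2}`. -/
def c (n : ℕ) : ℂ := ((Real.sqrt (∏ p ∈ Finset.Icc 1 n, (p ! : ℝ)))⁻¹ : ℝ)

/-- `ψ(F)(x) = c Δ(x) F|_D(x)`, where `x ∈ ℂ^n` is identified with the diagonal matrix with
diagonal `x`. -/
def psi {n : ℕ} (F : Matrix (Fin n) (Fin n) ℂ → ℂ) : (Fin n → ℂ) → ℂ :=
  fun x => c n * vdm x * F (Matrix.diagonal x)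

/-- `ψ` is a well-defined unitary map from `F(ℂ^{n×n})^U` to `F(ℂ^n)_alt`: it takes values in the
second space, and as such it is a linear bijection that preserves inner products. -/
def PsiUnitary (n : ℕ) : Prop :=
  ∃ Ψ : invSpace n ≃ₗ[ℂ] altSpace n, (∀ F : invSpace n, (Ψ F : (Fin n → ℂ) → ℂ) = psi F.1) ∧
    ∀ F G : invSpace n, innerProd (Ψ F).1 (Ψ G).1 = innerMat F.1 G.1

/-- The Harish-Chandra-Itzykson-Zuber integral formula for `n × n` matrices. -/
def HCIZ (n : ℕ) : Prop :=
  ∀ a b : Fin n → ℝ, StrictMono a → StrictMono b →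
    ∫ u : U n, Complex.exp ((u.1 * Matrix.diagonal (fun i => (a i : ℂ)) * (u⁻¹ : U n).1 *
        Matrix.diagonal (fun i => (b i : ℂ))).trace) ∂(haarU n) =
      (∏ p ∈ Finset.Icc 1 (n - 1), (p ! : ℂ)) *
        (Matrix.of fun i j : Fin n => Complex.exp ((a i : ℂ) * (b j : ℂ))).det /
        (vdm (fun i => (a i : ℂ)) * vdm (fun i => (b i : ℂ)))

end SegalBargmann

end

/-!
The argument compares two reproducing kernels. The coherent states `K_a` reproduce the values of
functions of the Segal-Bargmann space on `ℂ^ι` (`innerProd_expPairing`): after a translation by `a`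
this is the mean value property of entire functions against the Gaussian, which is invariant under
rotations. Averaging `K_a` over the unitary group, or antisymmetrizing it, gives the coherent states
`Q_a` and `R_a`, which reproduce the values of functions of the invariant and of the alternating
space (`innerMat_Q`, `innerProd_R`).

Both halves of the equivalence are equivalent to `KernelIdentity`: for all complex diagonal `x`
and `z`, `conj (c Δ(x)) * (c Δ(z)) * Q_x(z) = R_x(z)`.

* `R_x(z)` is `det [exp (conj (x i) * z j)] / n!`, so the integral formula is the kernel identity at
  real increasing arguments (`HCIZ_iff_real`). Both sides of the identity are entire in `z` and in
  `conj x`, and real increasing vectors are a set of uniqueness for entire functions on `ℂ^n`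
  (`eq_zero_of_vanish_strictMono`), so it extends to all arguments.
* The identity says that the families `conj (c Δ(x)) Q_x` and `R_x` have the same Gram matrix. Both
  are total in their spaces: an invariant function is determined by its values on real diagonal
  matrices (`eq_zero_of_vanish_diagonal`). The spaces are complete, because an `L²` limit of
  functions `F_n` is the entire function `a ↦ ⟨K_a, lim F_n⟩` (`exists_toL2_eq_of_tendsto`). Hence
  a unitary matches the two families, and pairing its values with `R_x` shows that it is `ψ`.
* Conversely, a unitary `ψ` satisfies `⟨R_x, ψ F⟩ = c Δ(x) F(x) = ⟨conj (c Δ(x)) Q_x, F⟩` for all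
  `F`, so `ψ⁻¹ R_x = conj (c Δ(x)) Q_x`, which is the kernel identity and the formula for `ψ(Q_x)`.
-/

noncomputable section

namespace SegalBargmann

variable {ι : Type} [Fintype ι]

/-! ### The Gaussian weight -/

theorem integrable_exp_neg_mul_sq_complex {b : ℝ} (hb : 0 < b) :
    Integrable (fun z : ℂ => Real.exp (-b * ‖z‖ ^ 2)) := by
  -- a non-integrable function would have integral `0`
  by_contra h
  have h1 := Complex.integral_exp_neg_mul_rpow (p := 2) (by norm_num) hb
  simp only [Real.rpow_two] at h1
  rw [integral_undef h] at h1
  have : 0 < Real.pi * b ^ (-2 / 2 : ℝ) * Real.Gamma (2 / 2 + 1) := by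
    have := Real.Gamma_pos_of_pos (s := 2 / 2 + 1) (by norm_num)
    positivity
  linarith

theorem exp_neg_mul_sum_sq (b : ℝ) (z : ι → ℂ) :
    Real.exp (-b * ∑ i, ‖z i‖ ^ 2) = ∏ i, Real.exp (-b * ‖z i‖ ^ 2) := by
  rw [Finset.mul_sum, Real.exp_sum]

theorem integrable_exp_neg_mul_sum_sq {b : ℝ} (hb : 0 < b) :
    Integrable (fun z : ι → ℂ => Real.exp (-b * ∑ i, ‖z i‖ ^ 2)) := by
  simp_rw [exp_neg_mul_sum_sq]
  exact Integrable.fintype_prod (f := fun _ z => Real.exp (-b * ‖z‖ ^ 2))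
    fun _ => integrable_exp_neg_mul_sq_complex hb

theorem integral_gaussian_pi :
    ∫ z : ι → ℂ, Real.exp (-∑ i, ‖z i‖ ^ 2) = Real.pi ^ Fintype.card ι := by
  have h := exp_neg_mul_sum_sq (ι := ι) 1
  simp only [neg_mul, one_mul] at h
  simp_rw [h]
  rw [integral_fintype_prod_volume_eq_pow (fun z : ℂ => Real.exp (-‖z‖ ^ 2))]
  have h1 := Complex.integral_exp_neg_rpow (p := 2) (by norm_num)
  simp only [Real.rpow_two] at h1
  rw [h1]
  norm_num [Real.Gamma_two]

/-- Entire functions of growth `exp (|z|² / 4)` are square integrable against the weight. -/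
theorem mem_space_of_growth {F : (ι → ℂ) → ℂ} (hF : Differentiable ℂ F) (C : ℝ)
    (h : ∀ z, ‖F z‖ ≤ C * Real.exp (4⁻¹ * ∑ i, ‖z i‖ ^ 2)) : F ∈ space ι := by
  refine ⟨hF, ((integrable_exp_neg_mul_sum_sq (ι := ι) (b := 2⁻¹) (by norm_num)).const_mul
    (C ^ 2)).mono' ?_ (.of_forall fun z => ?_)⟩
  · have := hF.continuous
    exact Continuous.aestronglyMeasurable (by fun_prop)
  · rw [Real.norm_of_nonneg (by positivity)]
    have h1 : ‖F z‖ ^ 2 ≤ (C * Real.exp (4⁻¹ * ∑ i, ‖z i‖ ^ 2)) ^ 2 :=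
      pow_le_pow_left₀ (norm_nonneg _) (h z) 2
    calc _ ≤ (C * Real.exp (4⁻¹ * ∑ i, ‖z i‖ ^ 2)) ^ 2 * Real.exp (-∑ i, ‖z i‖ ^ 2) := by gcongr
      _ = C ^ 2 * Real.exp (-2⁻¹ * ∑ i, ‖z i‖ ^ 2) := by
        rw [mul_pow, ← Real.exp_nat_mul, mul_assoc, ← Real.exp_add]
        congr 2
        push_cast; ring

theorem norm_sum_mul_le (a z : ι → ℂ) :
    ‖∑ i, z i * a i‖ ≤ 4⁻¹ * ∑ i, ‖z i‖ ^ 2 + ∑ i, ‖a i‖ ^ 2 := by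
  rw [Finset.mul_sum, ← Finset.sum_add_distrib]
  refine (norm_sum_le _ _).trans (Finset.sum_le_sum fun i _ => ?_)
  rw [norm_mul]
  nlinarith [sq_nonneg (2⁻¹ * ‖z i‖ - ‖a i‖)]

theorem norm_exp_pairing_le (a z : ι → ℂ) :
    ‖Complex.exp (∑ i, z i * a i)‖ ≤
      Real.exp (∑ i, ‖a i‖ ^ 2) * Real.exp (4⁻¹ * ∑ i, ‖z i‖ ^ 2) := by
  rw [Complex.norm_exp, ← Real.exp_add, Real.exp_le_exp]
  linarith [(Complex.re_le_norm _).trans (norm_sum_mul_le a z)]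

/-- The coherent state `K_a` on `ℂ^ι`, for an arbitrary finite index type; `coh` is the case
`ι = Fin n` and `cohMat`, in the coordinates given by the entries, the case `ι = Fin n × Fin n`. -/
def expPairing (a z : ι → ℂ) : ℂ := Complex.exp (∑ i, z i * conj (a i))

theorem expPairing_mem_space (a : ι → ℂ) : expPairing a ∈ space ι := by
  refine mem_space_of_growth (by unfold expPairing; fun_prop) (Real.exp (∑ i, ‖a i‖ ^ 2))
    fun z => ?_
  simpa [expPairing] using norm_exp_pairing_le (fun i => conj (a i)) z

theorem integrable_conj_mul_gaussian {F G : (ι → ℂ) → ℂ} (hF : F ∈ space ι) (hG : G ∈ space ι) :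
    Integrable fun z : ι → ℂ => conj (F z) * G z * (Real.exp (-∑ i, ‖z i‖ ^ 2) : ℂ) := by
  refine (hF.2.add hG.2).mono' ?_ (.of_forall fun z => ?_)
  · have h1 := hF.1.continuous
    have h2 := hG.1.continuous
    refine Continuous.aestronglyMeasurable ?_
    have h3 : Continuous fun z => conj (F z) := Complex.continuous_conj.comp h1
    fun_prop
  · simp only [Pi.add_apply]
    rw [← add_mul, norm_mul, norm_mul, RCLike.norm_conj, Complex.norm_real,
      Real.norm_of_nonneg (Real.exp_pos _).le]
    gcongr
    nlinarith [sq_nonneg (‖F z‖ - ‖G z‖)]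

/-! ### Holomorphic parameter integrals -/

/-- Integrals of `exp (∑ a i * f i) * g` over a parameter space are entire in `a`, provided that `g`
beats all exponentials of the `f i`. -/
theorem differentiable_integral_exp {Ω : Type*} [MeasurableSpace Ω] {μ : Measure Ω}
    {f : Ω → ι → ℂ} {g : Ω → ℂ} (hf : ∀ i, AEStronglyMeasurable (fun ω => f ω i) μ)
    (hg : AEStronglyMeasurable g μ)
    (h : ∀ C : ℝ, Integrable (fun ω => Real.exp (C * ∑ i, ‖f ω i‖) * ‖g ω‖) μ) :
    Differentiable ℂ fun a : ι → ℂ => ∫ ω, Complex.exp (∑ i, a i * f ω i) * g ω ∂μ := by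
  intro a₀
  have hbd : ∀ (a : ι → ℂ) ω, ‖Complex.exp (∑ i, a i * f ω i) * g ω‖ ≤
      Real.exp (‖a‖ * ∑ i, ‖f ω i‖) * ‖g ω‖ := by
    intro a ω
    rw [norm_mul, Complex.norm_exp]
    gcongr
    refine (Complex.re_le_norm _).trans ((norm_sum_le _ _).trans ?_)
    rw [Finset.mul_sum]
    refine Finset.sum_le_sum fun i _ => ?_
    rw [norm_mul]
    gcongr
    exact norm_le_pi_norm a i
  have hmeas : ∀ a : ι → ℂ,
      AEStronglyMeasurable (fun ω => Complex.exp (∑ i, a i * f ω i) * g ω) μ := fun a =>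
    (Complex.continuous_exp.comp_aestronglyMeasurable
      (Finset.aestronglyMeasurable_fun_sum _ fun i _ => (hf i).const_mul (a i))).mul hg
  refine (hasFDerivAt_integral_of_dominated_of_fderiv_le (𝕜 := ℂ)
    (F := fun (a : ι → ℂ) ω => Complex.exp (∑ i, a i * f ω i) * g ω)
    (F' := fun a ω => (Complex.exp (∑ i, a i * f ω i) * g ω) •
      ∑ i, f ω i • (ContinuousLinearMap.proj i : (ι → ℂ) →L[ℂ] ℂ))
    (bound := fun ω => Real.exp ((‖a₀‖ + 1 + 1) * ∑ i, ‖f ω i‖) * ‖g ω‖)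
    (Metric.ball_mem_nhds a₀ one_pos) (.of_forall hmeas)
    ((h ‖a₀‖).mono' (hmeas a₀) (.of_forall (hbd a₀))) ?_ (.of_forall fun ω a ha => ?_) (h _)
    (.of_forall fun ω a _ => ?_)).differentiableAt
  · exact (hmeas a₀).smul
      (Finset.aestronglyMeasurable_fun_sum _ fun i _ => (hf i).smul_const _)
  · have ha' : ‖a‖ ≤ ‖a₀‖ + 1 := by
      have h1 := norm_sub_norm_le a a₀
      have h2 := mem_ball_iff_norm.1 ha
      linarith
    have hS : 0 ≤ ∑ i, ‖f ω i‖ := Finset.sum_nonneg fun i _ => norm_nonneg _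
    have h1 : ‖∑ i, f ω i • (ContinuousLinearMap.proj i : (ι → ℂ) →L[ℂ] ℂ)‖ ≤ ∑ i, ‖f ω i‖ := by
      refine (norm_sum_le _ _).trans (Finset.sum_le_sum fun i _ => ?_)
      rw [norm_smul]
      refine mul_le_of_le_one_right (norm_nonneg _) ?_
      exact ContinuousLinearMap.opNorm_le_bound _ zero_le_one fun x => by
        simpa using norm_le_pi_norm x i
    rw [norm_smul]
    calc _ ≤ (Real.exp ((‖a₀‖ + 1) * ∑ i, ‖f ω i‖) * ‖g ω‖) * Real.exp (∑ i, ‖f ω i‖) := by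
          gcongr
          · refine (hbd a ω).trans ?_
            gcongr
          · exact h1.trans ((Real.add_one_le_exp _).trans' (by linarith))
      _ = _ := by
          rw [mul_right_comm, ← Real.exp_add]
          ring_nf
  · have h1 : HasFDerivAt (fun a : ι → ℂ => ∑ i, a i * f ω i)
        (∑ i, f ω i • (ContinuousLinearMap.proj i : (ι → ℂ) →L[ℂ] ℂ)) a :=
      HasFDerivAt.fun_sum fun i _ => (hasFDerivAt_apply i a).mul_const (f ω i)
    convert! h1.cexp.mul_const (g ω) using 1
    rw [smul_smul, mul_comm]

/-! ### The reproducing property -/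

theorem measurePreserving_smul_pi {w : ℂ} (hw : ‖w‖ = 1) :
    MeasurePreserving (fun z : ι → ℂ => w • z) := by
  have h := (rotation (⟨w, by simpa [Submonoid.unitSphere] using hw⟩ : Circle)).measurePreserving
  have h2 := volume_preserving_pi (fun _ : ι => h)
  convert! h2 using 1

/-- The mean value property against the Gaussian: the weight is invariant under the rotations
`z ↦ exp (iθ) z`, and the average of an entire function over these is its value at `0`. -/
theorem integral_mul_gaussian {G : (ι → ℂ) → ℂ} (hG : Differentiable ℂ G)
    (hint : Integrable fun z : ι → ℂ => G z * (Real.exp (-∑ i, ‖z i‖ ^ 2) : ℂ)) :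
    ∫ z : ι → ℂ, G z * (Real.exp (-∑ i, ‖z i‖ ^ 2) : ℂ) =
      (Real.pi : ℂ) ^ Fintype.card ι * G 0 := by
  have hGc := hG.continuous
  have hnorm : ∀ θ, ‖circleMap 0 1 θ‖ = 1 := fun θ => by simp
  set w : (ι → ℂ) → ℂ := fun z => (Real.exp (-∑ i, ‖z i‖ ^ 2) : ℂ) with hw
  have hwc : Continuous w := by fun_prop
  have hwi : ∀ θ z, w (circleMap 0 1 θ • z) = w z := fun θ z => by
    simp [hw]
  have hGw : Continuous fun z => G z * w z := hGc.mul hwc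
  have hrot : ∀ θ, ∫ z, G (circleMap 0 1 θ • z) * w z = ∫ z, G z * w z := fun θ => by
    have hp := measurePreserving_smul_pi (ι := ι) (hnorm θ)
    have h1 := integral_map (μ := volume) hp.measurable.aemeasurable
      (f := fun z => G z * w z) hGw.aestronglyMeasurable
    rw [hp.map_eq] at h1
    rw [h1]
    simp_rw [hwi]
  have hrotn : ∀ θ, ∫ z, ‖G (circleMap 0 1 θ • z) * w z‖ = ∫ z, ‖G z * w z‖ := fun θ => by
    have hp := measurePreserving_smul_pi (ι := ι) (hnorm θ)
    have h1 := integral_map (μ := volume) hp.measurable.aemeasurable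
      (f := fun z => ‖G z * w z‖) hGw.norm.aestronglyMeasurable
    rw [hp.map_eq] at h1
    rw [h1]
    simp_rw [hwi]
  have hcirc : Continuous (circleMap 0 1) := continuous_circleMap 0 1
  have hfub : ∫ θ in (0)..(2 * Real.pi), ∫ z, G (circleMap 0 1 θ • z) * w z =
      ∫ z, ∫ θ in (0)..(2 * Real.pi), G (circleMap 0 1 θ • z) * w z := by
    refine intervalIntegral_integral_swap ?_
    have hc : Continuous (Function.uncurry fun (θ : ℝ) (z : ι → ℂ) =>
        G (circleMap 0 1 θ • z) * w z) := by
      refine (hGc.comp ?_).mul (hwc.comp continuous_snd)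
      exact (hcirc.comp continuous_fst).smul continuous_snd
    rw [Set.uIoc_of_le (by positivity), integrable_prod_iff hc.aestronglyMeasurable]
    refine ⟨.of_forall fun θ => ?_, ?_⟩
    · have hp := measurePreserving_smul_pi (ι := ι) (hnorm θ)
      have := hp.integrable_comp_of_integrable hint
      refine this.congr (.of_forall fun z => ?_)
      simp only [Function.comp, Function.uncurry]
      rw [← hwi θ z]
    · simp only [Function.uncurry, hrotn]
      exact integrable_const _
  have hmean : ∀ z, ∫ θ in (0)..(2 * Real.pi), G (circleMap 0 1 θ • z) * w z =
      (2 * Real.pi) * G 0 * w z := fun z => by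
    have h1 : Real.circleAverage (fun t : ℂ => G (t • z)) 0 1 = G ((0 : ℂ) • z) :=
      DiffContOnCl.circleAverage (Differentiable.diffContOnCl
        (hG.comp (differentiable_id.smul_const z)))
    rw [Real.circleAverage_def, zero_smul] at h1
    rw [intervalIntegral.integral_mul_const, ← h1, Complex.real_smul, ← mul_assoc]
    have : (2 * Real.pi : ℂ) ≠ 0 := by simp [Real.pi_ne_zero]
    push_cast
    rw [mul_inv_cancel₀ this, one_mul]
  simp_rw [hrot, hmean] at hfub
  rw [integral_const_mul, intervalIntegral.integral_const] at hfub
  have hwint : ∫ z, w z = (Real.pi : ℂ) ^ Fintype.card ι := by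
    simp only [hw]
    rw [integral_complex_ofReal, integral_gaussian_pi]; push_cast; rfl
  rw [hwint, sub_zero, Complex.real_smul] at hfub
  have h2pi : (2 * Real.pi : ℂ) ≠ 0 := by simp [Real.pi_ne_zero]
  apply mul_left_cancel₀ h2pi
  push_cast at hfub
  rw [hfub]; ring

/-- The coherent states are the reproducing kernel of the Segal-Bargmann space. Translating by `a`
turns the Gaussian pairing with `K_a` into the mean value property at the origin. -/
theorem innerProd_expPairing {F : (ι → ℂ) → ℂ} (hF : F ∈ space ι) (a : ι → ℂ) :
    innerProd (expPairing a) F = F a := by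
  have hpt : ∀ z : ι → ℂ, conj (expPairing a (z + a)) * F (z + a) *
      (Real.exp (-∑ i, ‖(z + a) i‖ ^ 2) : ℂ) =
      (F (z + a) * Complex.exp (-∑ i, z i * conj (a i))) *
        (Real.exp (-∑ i, ‖z i‖ ^ 2) : ℂ) := fun z => by
    have h : conj (expPairing a (z + a)) * (Real.exp (-∑ i, ‖(z + a) i‖ ^ 2) : ℂ) =
      Complex.exp (-∑ i, z i * conj (a i)) * (Real.exp (-∑ i, ‖z i‖ ^ 2) : ℂ) := by
      unfold expPairing
      rw [← Complex.exp_conj]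
      push_cast
      rw [← Complex.exp_add, ← Complex.exp_add]
      congr 1
      simp only [map_sum, map_mul, Complex.conj_conj, Pi.add_apply, map_add,
        ← Complex.conj_mul', ← Finset.sum_neg_distrib, ← Finset.sum_add_distrib]
      exact Finset.sum_congr rfl fun i _ => by ring
    linear_combination F (z + a) * h
  have hint := (integrable_conj_mul_gaussian (expPairing_mem_space a) hF).comp_add_right a
  simp_rw [hpt] at hint
  have h0 : (Real.pi : ℂ) ^ Fintype.card ι ≠ 0 := by simp [Real.pi_ne_zero]
  unfold innerProd
  rw [← integral_add_right_eq_self _ a]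
  simp_rw [hpt]
  rw [integral_mul_gaussian _ hint]
  · simp [h0]
  · have hFd := hF.1
    exact (hFd.comp (differentiable_id.add_const a)).mul (by fun_prop)

/-! ### The Segal-Bargmann space inside `L²` -/

/-- The square root of the Gaussian density `π^{-|ι|} exp (-|z|²)`. -/
def sqrtGaussian (z : ι → ℂ) : ℝ :=
  (Real.sqrt Real.pi ^ Fintype.card ι)⁻¹ * Real.exp (-2⁻¹ * ∑ i, ‖z i‖ ^ 2)

theorem continuous_sqrtGaussian : Continuous (sqrtGaussian (ι := ι)) := by
  unfold sqrtGaussian; fun_prop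

theorem sqrtGaussian_pos (z : ι → ℂ) : 0 < sqrtGaussian z := by
  unfold sqrtGaussian
  have := Real.pi_pos
  positivity

theorem sqrtGaussian_sq (z : ι → ℂ) :
    sqrtGaussian z ^ 2 = (Real.pi ^ Fintype.card ι)⁻¹ * Real.exp (-∑ i, ‖z i‖ ^ 2) := by
  unfold sqrtGaussian
  rw [mul_pow, inv_pow, ← pow_mul, mul_comm _ 2, pow_mul, Real.sq_sqrt Real.pi_pos.le,
    ← Real.exp_nat_mul]
  congr 2
  push_cast; ring

theorem memLp_mul_sqrtGaussian {F : (ι → ℂ) → ℂ} (hF : F ∈ space ι) :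
    MemLp (fun z => F z * (sqrtGaussian z : ℂ)) 2 volume := by
  have h1 := hF.1.continuous
  have h2 := continuous_sqrtGaussian (ι := ι)
  rw [memLp_two_iff_integrable_sq_norm (Continuous.aestronglyMeasurable (by fun_prop))]
  refine (hF.2.const_mul (Real.pi ^ Fintype.card ι)⁻¹).congr (.of_forall fun z => ?_)
  simp only [norm_mul, Complex.norm_real, mul_pow, Real.norm_eq_abs, sq_abs, sqrtGaussian_sq]
  ring

/-- The isometric embedding `F ↦ F √γ` of the Segal-Bargmann space into `L²` of Lebesgue measure,
where `γ` is the Gaussian density. -/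
def toL2 : space ι →ₗ[ℂ] Lp ℂ 2 (volume : Measure (ι → ℂ)) where
  toFun F := (memLp_mul_sqrtGaussian F.2).toLp _
  map_add' F G := by
    rw [← MemLp.toLp_add]
    congr 1
    ext z
    simp [add_mul]
  map_smul' a F := by
    rw [RingHom.id_apply, ← MemLp.toLp_const_smul]
    congr 1
    ext z
    simp [mul_assoc]

theorem coeFn_toL2 (F : space ι) :
    toL2 F =ᵐ[volume] fun z => F.1 z * (sqrtGaussian z : ℂ) :=
  (memLp_mul_sqrtGaussian F.2).coeFn_toLp

theorem inner_toL2 (F G : space ι) : inner ℂ (toL2 F) (toL2 G) = innerProd F.1 G.1 := by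
  rw [L2.inner_def, innerProd, ← integral_const_mul]
  refine integral_congr_ae ?_
  filter_upwards [coeFn_toL2 F, coeFn_toL2 G] with z h1 h2
  have h3 := congrArg (fun t : ℝ => (t : ℂ)) (sqrtGaussian_sq z)
  push_cast at h3
  rw [h1, h2, RCLike.inner_apply, map_mul, Complex.conj_ofReal]
  push_cast
  linear_combination conj (F.1 z) * G.1 z * h3

/-- The coherent state `K_a` as an element of the Segal-Bargmann space. -/
def kernelState (a : ι → ℂ) : space ι := ⟨expPairing a, expPairing_mem_space a⟩

theorem inner_toL2_kernelState (F : space ι) (a : ι → ℂ) :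
    inner ℂ (toL2 (kernelState a)) (toL2 F) = F.1 a := by
  rw [inner_toL2]; exact innerProd_expPairing F.2 a

theorem innerProd_conj_symm {F G : (ι → ℂ) → ℂ} (hF : F ∈ space ι) (hG : G ∈ space ι) :
    conj (innerProd F G) = innerProd G F := by
  have h := inner_conj_symm (𝕜 := ℂ) (toL2 ⟨G, hG⟩) (toL2 ⟨F, hF⟩)
  rwa [inner_toL2, inner_toL2] at h

theorem toL2_injective : Function.Injective (toL2 (ι := ι)) := by
  intro F G h
  ext a
  rw [← inner_toL2_kernelState F, h, inner_toL2_kernelState]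

theorem memLp_exp_mul_sqrtGaussian (C : ℝ) :
    MemLp (fun z : ι → ℂ => Real.exp (C * ∑ i, ‖z i‖) * sqrtGaussian z) 2 volume := by
  have h2 := continuous_sqrtGaussian (ι := ι)
  have hc : Continuous fun z : ι → ℂ => Real.exp (C * ∑ i, ‖z i‖) * sqrtGaussian z := by fun_prop
  rw [memLp_two_iff_integrable_sq_norm hc.aestronglyMeasurable]
  refine ((integrable_exp_neg_mul_sum_sq (ι := ι) (b := 2⁻¹) (by norm_num)).const_mul
    ((Real.pi ^ Fintype.card ι)⁻¹ * Real.exp (∑ _i : ι, 2 * C ^ 2))).mono'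
    (by fun_prop) (.of_forall fun z => ?_)
  rw [Real.norm_of_nonneg (by positivity), Real.norm_eq_abs, sq_abs, mul_pow, sqrtGaussian_sq,
    ← Real.exp_nat_mul, mul_left_comm, mul_assoc, ← Real.exp_add, ← Real.exp_add]
  have hp : 0 < (Real.pi ^ Fintype.card ι)⁻¹ := by have := Real.pi_pos; positivity
  refine mul_le_mul_of_nonneg_left (Real.exp_le_exp.2 ?_) hp.le
  rw [← sub_eq_add_neg, Finset.mul_sum, Finset.mul_sum, Finset.mul_sum, ← Finset.sum_sub_distrib,
    ← Finset.sum_add_distrib]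
  refine Finset.sum_le_sum fun i _ => ?_
  push_cast
  nlinarith [sq_nonneg (2 * C - ‖z i‖)]

/-- Every element of `L²` pairs with the coherent states to an entire function. -/
theorem differentiable_inner_kernelState (f : Lp ℂ 2 (volume : Measure (ι → ℂ))) :
    Differentiable ℂ fun a : ι → ℂ => inner ℂ (toL2 (kernelState a)) f := by
  have hc := continuous_sqrtGaussian (ι := ι)
  have heq : (fun a : ι → ℂ => inner ℂ (toL2 (kernelState a)) f) =
      fun a : ι → ℂ => ∫ z : ι → ℂ, Complex.exp (∑ i, a i * conj (z i)) *
        ((sqrtGaussian z : ℂ) * f z) := by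
    ext a
    rw [L2.inner_def]
    refine integral_congr_ae ?_
    filter_upwards [coeFn_toL2 (kernelState a)] with z h1
    rw [h1, RCLike.inner_apply, map_mul, Complex.conj_ofReal]
    simp only [kernelState, expPairing, ← Complex.exp_conj, map_sum, map_mul, Complex.conj_conj]
    simp_rw [mul_comm (conj (z _))]
    ring
  rw [heq]
  refine differentiable_integral_exp (f := fun (z : ι → ℂ) i => conj (z i)) (fun i => ?_) ?_
    fun C => ?_
  · exact (Complex.continuous_conj.comp (continuous_apply i)).aestronglyMeasurable
  · exact (Complex.continuous_ofReal.comp hc).aestronglyMeasurable.mul (Lp.aestronglyMeasurable f)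
  · refine ((memLp_exp_mul_sqrtGaussian C).integrable_mul (Lp.memLp f).norm).congr
      (.of_forall fun z => ?_)
    simp [abs_of_pos (sqrtGaussian_pos z), mul_assoc]

/-- An `L²` limit of functions of the Segal-Bargmann space is in the space, and is a pointwise
limit. -/
theorem exists_toL2_eq_of_tendsto {F : ℕ → space ι} {f : Lp ℂ 2 (volume : Measure (ι → ℂ))}
    (h : Filter.Tendsto (fun n => toL2 (F n)) Filter.atTop (nhds f)) :
    ∃ G : space ι, toL2 G = f ∧
      ∀ a, Filter.Tendsto (fun n => (F n).1 a) Filter.atTop (nhds (G.1 a)) := by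
  set G : (ι → ℂ) → ℂ := fun a => inner ℂ (toL2 (kernelState a)) f with hG
  have hlim : ∀ a, Filter.Tendsto (fun n => (F n).1 a) Filter.atTop (nhds (G a)) := fun a => by
    have := (tendsto_const_nhds (x := toL2 (kernelState a))).inner (𝕜 := ℂ) h
    simpa only [inner_toL2_kernelState] using this
  have hae : f =ᵐ[volume] fun z => G z * (sqrtGaussian z : ℂ) := by
    obtain ⟨s, hs, hs'⟩ := (tendstoInMeasure_of_tendsto_Lp h).exists_seq_tendsto_ae
    filter_upwards [hs', ae_all_iff.2 fun n => coeFn_toL2 (F n)] with z h1 h2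
    simp_rw [h2] at h1
    exact tendsto_nhds_unique h1 (((hlim z).comp hs.tendsto_atTop).mul_const _)
  have hmem : G ∈ space ι := by
    refine ⟨differentiable_inner_kernelState f, ?_⟩
    have h1 := (Lp.memLp f).ae_eq hae
    rw [memLp_two_iff_integrable_sq_norm h1.1] at h1
    refine (h1.const_mul (Real.pi ^ Fintype.card ι)).congr (.of_forall fun z => ?_)
    have hp : Real.pi ^ Fintype.card ι ≠ 0 := by simp [Real.pi_ne_zero]
    simp only [norm_mul, Complex.norm_real, mul_pow, Real.norm_eq_abs, sq_abs, sqrtGaussian_sq]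
    field_simp
  refine ⟨⟨G, hmem⟩, ?_, hlim⟩
  exact Lp.ext ((coeFn_toL2 _).trans hae.symm)

/-- A linear family of functions of the Segal-Bargmann space that is stable under pointwise limits
is a Hilbert space. -/
theorem completeSpace_range_toL2 {H : Type*} [AddCommGroup H] [Module ℂ H] (r : H →ₗ[ℂ] space ι)
    (hr : ∀ (F : ℕ → H) (G : space ι),
      (∀ a, Filter.Tendsto (fun n => (r (F n)).1 a) Filter.atTop (nhds (G.1 a))) →
        G ∈ LinearMap.range r) :
    CompleteSpace (LinearMap.range (toL2 ∘ₗ r)) := by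
  refine IsClosed.completeSpace_coe (hs := ?_)
  refine IsSeqClosed.isClosed fun x f hx hf => ?_
  choose F hF using hx
  simp only [LinearMap.comp_apply] at hF
  obtain ⟨G, hG, hlim⟩ := exists_toL2_eq_of_tendsto (F := fun n => r (F n)) (by simpa [hF] using hf)
  obtain ⟨K, rfl⟩ := hr F G hlim
  exact ⟨K, hG⟩

/-! ### Unitaries from equal Gram matrices -/

theorem denseRange_linearCombination {X E : Type*} [NormedAddCommGroup E] [InnerProductSpace ℂ E]
    [CompleteSpace E] (k : X → E) (h : ∀ v, (∀ x, inner ℂ (k x) v = 0) → v = 0) :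
    DenseRange (Finsupp.linearCombination ℂ k) := by
  have h1 : (Submodule.span ℂ (Set.range k)).topologicalClosure = ⊤ := by
    rw [Submodule.topologicalClosure_eq_top_iff, Submodule.eq_bot_iff]
    intro v hv
    exact h v fun x => (Submodule.mem_orthogonal _ _).1 hv _ (Submodule.subset_span ⟨x, rfl⟩)
  have h2 := Submodule.dense_iff_topologicalClosure_eq_top.2 h1
  rwa [← Finsupp.range_linearCombination] at h2

/-- Two total families in Hilbert spaces with the same Gram matrix are matched by a unitary. -/
theorem exists_linearIsometryEquiv_of_gram {X E₁ E₂ : Type*}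
    [NormedAddCommGroup E₁] [InnerProductSpace ℂ E₁] [CompleteSpace E₁]
    [NormedAddCommGroup E₂] [InnerProductSpace ℂ E₂] [CompleteSpace E₂]
    (k₁ : X → E₁) (k₂ : X → E₂) (hk : ∀ x y, inner ℂ (k₁ x) (k₁ y) = inner ℂ (k₂ x) (k₂ y))
    (h₁ : ∀ v, (∀ x, inner ℂ (k₁ x) v = 0) → v = 0)
    (h₂ : ∀ v, (∀ x, inner ℂ (k₂ x) v = 0) → v = 0) :
    ∃ T : E₁ ≃ₗᵢ[ℂ] E₂, ∀ x, T (k₁ x) = k₂ x := by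
  have hnorm : ∀ x : X →₀ ℂ, ‖Finsupp.linearCombination ℂ k₂ x‖ =
      ‖Finsupp.linearCombination ℂ k₁ x‖ := by
    intro x
    have h : inner ℂ (Finsupp.linearCombination ℂ k₂ x) (Finsupp.linearCombination ℂ k₂ x) =
        inner ℂ (Finsupp.linearCombination ℂ k₁ x) (Finsupp.linearCombination ℂ k₁ x) := by
      simp only [Finsupp.linearCombination_apply, Finsupp.sum, sum_inner, inner_sum,
        inner_smul_left, inner_smul_right, hk]
    rw [@norm_eq_sqrt_re_inner ℂ, @norm_eq_sqrt_re_inner ℂ, h]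
  have hd₁ := denseRange_linearCombination k₁ h₁
  have hd₂ := denseRange_linearCombination k₂ h₂
  refine ⟨(LinearEquiv.refl ℂ (X →₀ ℂ)).extendOfIsometry _ _ hd₁ hd₂ (by simpa using hnorm),
    fun x => ?_⟩
  have := LinearEquiv.extendOfIsometry_eq (LinearEquiv.refl ℂ (X →₀ ℂ)) _ _ hd₁ hd₂
    (by simpa using hnorm) (Finsupp.single x 1)
  simpa using this

/-! ### Uniqueness for entire functions -/

/-- An entire function of one variable that vanishes at all small positive reals is zero. -/
theorem eq_zero_of_vanish_real {f : ℂ → ℂ} (hf : Differentiable ℂ f) {ε : ℝ} (hε : 0 < ε)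
    (h : ∀ t : ℝ, 0 < t → t < ε → f t = 0) (z : ℂ) : f z = 0 := by
  have ha : AnalyticOnNhd ℂ f Set.univ := fun z _ => hf.analyticAt z
  refine ha.eqOn_zero_of_preconnected_of_frequently_eq_zero isPreconnected_univ
    (Set.mem_univ (0 : ℂ)) ?_ (Set.mem_univ z)
  have ht : Filter.Tendsto (fun t : ℝ => (t : ℂ)) (nhdsWithin 0 (Set.Ioi 0))
      (nhdsWithin 0 {0}ᶜ) := by
    refine tendsto_nhdsWithin_iff.2 ⟨?_, ?_⟩
    · exact (Complex.continuous_ofReal.tendsto' 0 0 (by simp)).mono_left nhdsWithin_le_nhds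
    · filter_upwards [self_mem_nhdsWithin] with t ht
      simpa using (ne_of_gt ht : t ≠ 0)
  refine ht.frequently (Filter.Eventually.frequently ?_)
  filter_upwards [Ioo_mem_nhdsGT hε] with t ht
  exact h t ht.1 ht.2

/-- Real vectors with strictly increasing coordinates are a set of uniqueness for entire functions
on `ℂ^n`: every real vector is on a line that starts inside this cone, and every complex vector is
on a complex line with real base point and direction. -/
theorem eq_zero_of_vanish_strictMono {n : ℕ} {f : (Fin n → ℂ) → ℂ} (hf : Differentiable ℂ f)
    (h : ∀ a : Fin n → ℝ, StrictMono a → f (fun i => (a i : ℂ)) = 0) (z : Fin n → ℂ) :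
    f z = 0 := by
  have hreal : ∀ x : Fin n → ℝ, f (fun i => (x i : ℂ)) = 0 := by
    intro x
    have hd : Differentiable ℂ fun t : ℂ =>
        f (fun i => ((i : ℕ) : ℂ) + t * ((x i : ℂ) - ((i : ℕ) : ℂ))) :=
      hf.comp (differentiable_pi.2 fun i => by fun_prop)
    set B : ℝ := ∑ i, |x i - ((i : ℕ) : ℝ)| with hB
    have hB0 : 0 ≤ B := Finset.sum_nonneg fun i _ => abs_nonneg _
    have h1 := eq_zero_of_vanish_real hd (ε := (2 * B + 1)⁻¹) (by positivity) ?_ 1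
    · simpa using h1
    · intro t ht0 ht
      have := h (fun i => ((i : ℕ) : ℝ) + t * (x i - ((i : ℕ) : ℝ))) ?_
      · simpa using this
      · intro i j hij
        have hij' : ((i : ℕ) : ℝ) + 1 ≤ ((j : ℕ) : ℝ) := by exact_mod_cast hij
        have hle : ∀ i, |x i - ((i : ℕ) : ℝ)| ≤ B := fun i =>
          Finset.single_le_sum (f := fun i : Fin n => |x i - ((i : ℕ) : ℝ)|)
            (fun i _ => abs_nonneg _) (Finset.mem_univ i)
        have hi := (abs_le.1 (hle i)).2
        have hj := (abs_le.1 (hle j)).1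
        have htB : t * (2 * B + 1) < 1 := by
          rwa [lt_inv_comm₀ ht0 (by positivity), lt_inv_comm₀ (by positivity) ht0,
            ← one_div, lt_div_iff₀ (by positivity)] at ht
        dsimp only
        nlinarith
  have hd : Differentiable ℂ fun t : ℂ => f (fun i => ((z i).re : ℂ) + t * ((z i).im : ℂ)) :=
    hf.comp (differentiable_pi.2 fun i => by fun_prop)
  have h1 := eq_zero_of_vanish_real hd one_pos ?_ Complex.I
  · simpa [mul_comm Complex.I, Complex.re_add_im] using h1
  · intro t _ _
    simpa using hreal fun i => (z i).re + t * (z i).im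

/-- A conjugation invariant entire function on matrices is determined by its values at the real
diagonal matrices: these determine it on Hermitian matrices, by diagonalization, and the Hermitian
matrices are a real form of all matrices. -/
theorem eq_zero_of_vanish_diagonal {n : ℕ} {F : Matrix (Fin n) (Fin n) ℂ → ℂ}
    (hF : Differentiable ℂ fun z => F (toMat z))
    (hinv : ∀ (u : U n) (z : Matrix (Fin n) (Fin n) ℂ), F z = F ((u⁻¹ : U n).1 * z * u.1))
    (h : ∀ a : Fin n → ℝ, F (Matrix.diagonal fun i => (a i : ℂ)) = 0)
    (z : Matrix (Fin n) (Fin n) ℂ) : F z = 0 := by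
  have hherm : ∀ A : Matrix (Fin n) (Fin n) ℂ, A.IsHermitian → F A = 0 := by
    intro A hA
    rw [hinv hA.eigenvectorUnitary A]
    have h3 : (hA.eigenvectorUnitary⁻¹ : U n).1 * hA.eigenvectorUnitary.1 = 1 := by
      simp
    have h4 : (star hA.eigenvectorUnitary : Matrix (Fin n) (Fin n) ℂ) *
        hA.eigenvectorUnitary.1 = 1 := by
      simp
    have h2 : ((hA.eigenvectorUnitary⁻¹ : U n).1 * A * hA.eigenvectorUnitary.1) =
        Matrix.diagonal fun i => (hA.eigenvalues i : ℂ) := by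
      refine (congrArg (fun M => (hA.eigenvectorUnitary⁻¹ : U n).1 * M *
        hA.eigenvectorUnitary.1) hA.spectral_theorem).trans ?_
      rw [Unitary.conjStarAlgAut_apply, mul_assoc, mul_assoc, mul_assoc, h4, mul_one, ← mul_assoc,
        h3, one_mul]
      rfl
    rw [h2]
    exact h _
  -- the Hermitian and skew-Hermitian parts of `z`
  set A : Matrix (Fin n) (Fin n) ℂ := (2⁻¹ : ℂ) • (z + zᴴ) with hA
  set B : Matrix (Fin n) (Fin n) ℂ := (-Complex.I * 2⁻¹ : ℂ) • (z - zᴴ) with hB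
  have hAh : A.IsHermitian := by
    ext i j
    simp [hA, add_comm]
  have hBh : B.IsHermitian := by
    ext i j
    simp [hB]
    ring
  have hz : A + Complex.I • B = z := by
    ext i j
    simp only [hA, hB, Matrix.add_apply, Matrix.smul_apply, Matrix.sub_apply, smul_eq_mul]
    linear_combination (-2⁻¹ * (z i j - zᴴ i j)) * Complex.I_mul_I
  have hd : Differentiable ℂ fun t : ℂ => F (A + t • B) := by
    have := hF.comp (g := fun z => F (toMat z))
      (f := fun (t : ℂ) (p : Fin n × Fin n) => A p.1 p.2 + t * B p.1 p.2)
      (differentiable_pi.2 fun i => by fun_prop)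
    exact this
  have h1 := eq_zero_of_vanish_real hd one_pos ?_ Complex.I
  · rwa [hz] at h1
  · intro t _ _
    refine hherm _ (hAh.add ?_)
    ext i j
    have := congrFun (congrFun hBh i) j
    simp only [Matrix.conjTranspose_apply, Matrix.smul_apply, smul_eq_mul, star_mul',
      Complex.star_def, Complex.conj_ofReal] at this ⊢
    rw [this]

/-! ### Coherent states of the invariant space -/

instance isProbabilityMeasure_haarU (n : ℕ) : IsProbabilityMeasure (haarU n) := ⟨haarU_univ n⟩

instance isMulLeftInvariant_haarU (n : ℕ) : (haarU n).IsMulLeftInvariant :=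
  inferInstanceAs
    (Measure.haarMeasure (⊤ : TopologicalSpace.PositiveCompacts (U n))).IsMulLeftInvariant

theorem continuous_val_U {n : ℕ} : Continuous fun u : U n => u.1 := continuous_subtype_val

theorem continuous_inv_U {n : ℕ} : Continuous fun u : U n => (u⁻¹ : U n).1 :=
  continuous_subtype_val.comp continuous_inv

theorem integrable_haarU {n : ℕ} {E : Type*} [NormedAddCommGroup E]
    [SecondCountableTopology E] {f : U n → E} (hf : Continuous f) : Integrable f (haarU n) := by
  obtain ⟨C, hC⟩ := isCompact_univ.exists_bound_of_continuousOn hf.continuousOn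
  exact Integrable.of_bound hf.aestronglyMeasurable C (.of_forall fun u => hC u (Set.mem_univ u))

theorem differentiable_integral_exp_haarU {n : ℕ} {ι : Type} [Fintype ι] {f : U n → ι → ℂ}
    (hf : Continuous f) :
    Differentiable ℂ fun a : ι → ℂ => ∫ u, Complex.exp (∑ i, a i * f u i) ∂(haarU n) := by
  have hi : ∀ i, Continuous fun u => f u i := fun i => (continuous_apply i).comp hf
  simpa using differentiable_integral_exp (μ := haarU n) (f := f) (g := fun _ => 1)
    (fun i => (hi i).aestronglyMeasurable) aestronglyMeasurable_const
    (fun C => integrable_haarU (by fun_prop))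

/-- The vector of entries of a matrix, inverse to `toMat`. -/
def entries {n : ℕ} (a : Matrix (Fin n) (Fin n) ℂ) : Fin n × Fin n → ℂ := fun p => a p.1 p.2

theorem cohMat_eq {n : ℕ} (a z : Matrix (Fin n) (Fin n) ℂ) :
    cohMat a z = expPairing (entries a) (entries z) := by
  simp [cohMat, expPairing, entries, Matrix.trace, Matrix.mul_apply, Fintype.sum_prod_type]

/-- Conjugating the argument of a coherent state is the same as conjugating its label. -/
theorem cohMat_conj {n : ℕ} (u : U n) (a z : Matrix (Fin n) (Fin n) ℂ) :
    cohMat a ((u⁻¹ : U n).1 * z * u.1) = cohMat (u.1 * a * (u⁻¹ : U n).1) z := by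
  have h1 : (u⁻¹ : U n).1ᴴ = u.1 := by simp [← star_eq_conjTranspose]
  have h2 : u.1ᴴ = (u⁻¹ : U n).1 := by simp [← star_eq_conjTranspose]
  rw [cohMat, cohMat, conjTranspose_mul, conjTranspose_mul, h1, h2, mul_assoc, mul_assoc,
    Matrix.trace_mul_comm, mul_assoc, mul_assoc]

theorem continuous_entries_conj {n : ℕ} (a : Matrix (Fin n) (Fin n) ℂ) :
    Continuous fun u : U n => entries (u.1 * a * (u⁻¹ : U n).1) := by
  have h : Continuous fun u : U n => u.1 * a * (u⁻¹ : U n).1 :=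
    (continuous_val_U.mul continuous_const).mul continuous_inv_U
  exact continuous_pi fun p => h.matrix_elem p.1 p.2

theorem Q_toMat {n : ℕ} (a : Matrix (Fin n) (Fin n) ℂ) (z : Fin n × Fin n → ℂ) :
    Q a (toMat z) =
      ∫ u : U n, expPairing (entries (u.1 * a * (u⁻¹ : U n).1)) z ∂(haarU n) := by
  simp only [Q, cohMat_conj]
  simp only [cohMat_eq]
  rfl

theorem exists_bound_expPairing_conj {n : ℕ} (a : Matrix (Fin n) (Fin n) ℂ) :
    ∃ C : ℝ, ∀ (u : U n) (z : Fin n × Fin n → ℂ),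
      ‖expPairing (entries (u.1 * a * (u⁻¹ : U n).1)) z‖ ≤
        C * Real.exp (4⁻¹ * ∑ p, ‖z p‖ ^ 2) := by
  have hc : Continuous fun u : U n =>
      Real.exp (∑ p, ‖entries (u.1 * a * (u⁻¹ : U n).1) p‖ ^ 2) := by
    have h := continuous_entries_conj a
    have hp : ∀ p, Continuous fun u : U n => entries (u.1 * a * (u⁻¹ : U n).1) p :=
      fun p => (continuous_apply p).comp h
    fun_prop
  obtain ⟨C, hC⟩ := isCompact_univ.exists_bound_of_continuousOn hc.continuousOn
  refine ⟨C, fun u z => ?_⟩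
  have h1 := hC u (Set.mem_univ u)
  rw [Real.norm_of_nonneg (Real.exp_pos _).le] at h1
  have h2 := norm_exp_pairing_le (fun p => conj (entries (u.1 * a * (u⁻¹ : U n).1) p)) z
  simp only [RCLike.norm_conj] at h2
  exact h2.trans (by gcongr)

theorem Q_mem_invSpace {n : ℕ} (a : Matrix (Fin n) (Fin n) ℂ) : Q a ∈ invSpace n := by
  obtain ⟨C, hC⟩ := exists_bound_expPairing_conj a
  refine ⟨?_, fun v z => ?_⟩
  · refine mem_space_of_growth ?_ C fun z => ?_
    · simp only [Q_toMat, expPairing]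
      refine differentiable_integral_exp_haarU
        (f := fun u p => conj (entries (u.1 * a * (u⁻¹ : U n).1) p)) ?_
      exact continuous_pi fun p => Complex.continuous_conj.comp
        ((continuous_apply p).comp (continuous_entries_conj a))
    · rw [Q_toMat]
      simpa using norm_integral_le_of_norm_le_const (μ := haarU n)
        (.of_forall fun u => hC u z)
  · unfold Q
    rw [← integral_mul_left_eq_self _ v]
    refine integral_congr_ae (.of_forall fun u => ?_)
    simp only [_root_.mul_inv_rev, Submonoid.coe_mul, mul_assoc]

/-- The `Q_a` are the reproducing kernel of the invariant space: they are averages of the coherent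
states with labels `u a u⁻¹`, on which invariant functions are constant. -/
theorem innerMat_Q {n : ℕ} {F : Matrix (Fin n) (Fin n) ℂ → ℂ} (hF : F ∈ invSpace n)
    (a : Matrix (Fin n) (Fin n) ℂ) : innerMat (Q a) F = F a := by
  obtain ⟨C, hC⟩ := exists_bound_expPairing_conj a
  set F' : (Fin n × Fin n → ℂ) → ℂ := fun z => F (toMat z) with hF'
  have hF'm : F' ∈ space (Fin n × Fin n) := hF.1
  have hF'c : Continuous F' := hF'm.1.continuous
  set k : U n → (Fin n × Fin n → ℂ) → ℂ :=
    fun u z => expPairing (entries (u.1 * a * (u⁻¹ : U n).1)) z with hk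
  have hkc : Continuous fun p : (Fin n × Fin n → ℂ) × U n => k p.2 p.1 := by
    simp only [hk, expPairing]
    refine Complex.continuous_exp.comp (continuous_finsetSum _ fun q _ => ?_)
    exact ((continuous_apply q).comp continuous_fst).mul (Complex.continuous_conj.comp
      ((continuous_apply q).comp ((continuous_entries_conj a).comp continuous_snd)))
  have hbound : Integrable fun z : Fin n × Fin n → ℂ => |C| *
      (‖F' z‖ ^ 2 * Real.exp (-∑ p, ‖z p‖ ^ 2) + Real.exp (-2⁻¹ * ∑ p, ‖z p‖ ^ 2)) :=
    (hF'm.2.add (integrable_exp_neg_mul_sum_sq (by norm_num))).const_mul |C|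
  have hint : Integrable (Function.uncurry fun (z : Fin n × Fin n → ℂ) (u : U n) =>
      conj (k u z) * F' z * (Real.exp (-∑ p, ‖z p‖ ^ 2) : ℂ)) (volume.prod (haarU n)) := by
    refine (hbound.comp_fst (haarU n)).mono' ?_ (.of_forall fun p => ?_)
    · refine Continuous.aestronglyMeasurable ?_
      refine ((Complex.continuous_conj.comp hkc).mul (hF'c.comp continuous_fst)).mul ?_
      fun_prop
    · obtain ⟨z, u⟩ := p
      simp only [Function.uncurry]
      rw [norm_mul, norm_mul, RCLike.norm_conj, Complex.norm_real,
        Real.norm_of_nonneg (Real.exp_pos _).le]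
      set S := ∑ p, ‖z p‖ ^ 2
      have h1 : ‖k u z‖ ≤ |C| * Real.exp (4⁻¹ * S) :=
        (hC u z).trans (by gcongr; exact le_abs_self C)
      have h2 : Real.exp (-2⁻¹ * S) = Real.exp (4⁻¹ * S) ^ 2 * Real.exp (-S) := by
        rw [← Real.exp_nat_mul, ← Real.exp_add]; congr 1; push_cast; ring
      calc _ ≤ |C| * Real.exp (4⁻¹ * S) * ‖F' z‖ * Real.exp (-S) := by gcongr
        _ = |C| * (Real.exp (4⁻¹ * S) * ‖F' z‖ * Real.exp (-S)) := by ring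
        _ ≤ _ := by
          rw [h2, ← add_mul]
          gcongr
          nlinarith [sq_nonneg (Real.exp (4⁻¹ * S) - ‖F' z‖),
            mul_nonneg (Real.exp_pos (4⁻¹ * S)).le (norm_nonneg (F' z))]
  have h1 : ∀ z : Fin n × Fin n → ℂ, conj (Q a (toMat z)) * F' z *
      (Real.exp (-∑ p, ‖z p‖ ^ 2) : ℂ) =
      ∫ u : U n, conj (k u z) * F' z * (Real.exp (-∑ p, ‖z p‖ ^ 2) : ℂ) ∂(haarU n) := fun z => by
    rw [integral_mul_const, integral_mul_const, Q_toMat, ← integral_conj]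
  have h2 : ∀ u : U n, innerProd (k u) F' = F a := fun u => by
    change innerProd (expPairing _) F' = F a
    rw [innerProd_expPairing hF'm, hF.2 u⁻¹ a, inv_inv]
    rfl
  rw [innerMat, innerProd]
  change _ * ∫ z, conj (Q a (toMat z)) * F' z * (Real.exp (-∑ p, ‖z p‖ ^ 2) : ℂ) = _
  simp_rw [h1]
  rw [integral_integral_swap hint, ← integral_const_mul]
  calc _ = ∫ u : U n, innerProd (k u) F' ∂(haarU n) := rfl
    _ = F a := by simp [h2]

/-! ### Coherent states of the alternating space -/

theorem coh_perm {n : ℕ} (a z : Fin n → ℂ) (σ : Equiv.Perm (Fin n)) :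
    coh a (fun i => z (σ⁻¹ i)) = expPairing (fun i => a (σ i)) z := by
  simp only [coh, expPairing]
  rw [← Equiv.sum_comp σ]
  simp

/-- The coherent state `R_a` as a combination of coherent states of the full space. -/
def altState {n : ℕ} (a : Fin n → ℂ) : space (Fin n) :=
  (n ! : ℂ)⁻¹ • ∑ σ : Equiv.Perm (Fin n), ((Equiv.Perm.sign σ : ℤ) : ℂ) •
    kernelState fun i => a (σ i)

theorem altState_coe {n : ℕ} (a : Fin n → ℂ) : (altState a).1 = R a := by
  ext z
  simp only [R, coh_perm]
  simp [altState, kernelState, Finset.sum_apply]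

theorem R_mem_altSpace {n : ℕ} (a : Fin n → ℂ) : R a ∈ altSpace n := by
  refine ⟨altState_coe a ▸ (altState a).2, fun τ z => ?_⟩
  simp only [R]
  rw [mul_left_comm]
  congr 1
  rw [Finset.mul_sum]
  refine (Equiv.sum_comp (Equiv.mulRight τ) _).symm.trans ?_
  refine Finset.sum_congr rfl fun σ _ => ?_
  simp only [Equiv.coe_mulRight, Equiv.Perm.sign_mul, _root_.mul_inv_rev, Equiv.Perm.mul_apply]
  push_cast
  ring

theorem innerProd_R {n : ℕ} {G : (Fin n → ℂ) → ℂ} (hG : G ∈ altSpace n) (a : Fin n → ℂ) :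
    innerProd (R a) G = G a := by
  have h := inner_toL2 (altState a) ⟨G, hG.1⟩
  rw [altState_coe] at h
  rw [← h, altState, map_smul, map_sum, inner_smul_left, sum_inner]
  have h1 : ∀ σ : Equiv.Perm (Fin n), inner ℂ (toL2 (((Equiv.Perm.sign σ : ℤ) : ℂ) •
      kernelState fun i => a (σ i))) (toL2 ⟨G, hG.1⟩) = G a := fun σ => by
    rw [map_smul, inner_smul_left, inner_toL2_kernelState, hG.2 σ⁻¹ a]
    simp
  simp only [h1, Finset.sum_const, Finset.card_univ, Fintype.card_perm, Fintype.card_fin]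
  have : (n ! : ℂ) ≠ 0 := by exact_mod_cast Nat.factorial_ne_zero n
  simp [this]

theorem R_eq_det {n : ℕ} (a z : Fin n → ℂ) : R a z = (n ! : ℂ)⁻¹ *
    (Matrix.of fun i j : Fin n => Complex.exp (conj (a i) * z j)).det := by
  rw [R, Matrix.det_apply]
  congr 1
  refine Finset.sum_congr rfl fun σ _ => ?_
  rw [coh_perm, expPairing, Complex.exp_sum, Units.smul_def, zsmul_eq_mul]
  simp [mul_comm]

/-! ### The kernel identity -/

/-- The kernels of the two spaces, restricted to the diagonal and multiplied by the Vandermonde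
factors of `ψ`, agree. -/
def KernelIdentity (n : ℕ) : Prop := ∀ x z : Fin n → ℂ,
  conj (c n * vdm x) * (c n * vdm z) * Q (Matrix.diagonal x) (Matrix.diagonal z) = R x z

theorem conj_c (n : ℕ) : conj (c n) = c n := Complex.conj_ofReal _

theorem conj_vdm {n : ℕ} (x : Fin n → ℂ) : conj (vdm x) = vdm fun i => conj (x i) := by
  simp [vdm]

theorem vdm_ne_zero {n : ℕ} {x : Fin n → ℂ} (hx : Function.Injective x) : vdm x ≠ 0 := by
  refine Finset.prod_ne_zero_iff.2 fun i _ => Finset.prod_ne_zero_iff.2 fun j hj => ?_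
  exact sub_ne_zero.2 (hx.ne (Finset.mem_Ioi.1 hj).ne')

theorem c_sq_mul (n : ℕ) :
    c n * c n * ∏ p ∈ Finset.Icc 1 (n - 1), (p ! : ℂ) = (n ! : ℂ)⁻¹ := by
  have h0 : 0 < ∏ p ∈ Finset.Icc 1 n, (p ! : ℝ) := Finset.prod_pos fun p _ => by positivity
  have h1 : c n * c n = (∏ p ∈ Finset.Icc 1 n, (p ! : ℂ))⁻¹ := by
    rw [c, ← Complex.ofReal_mul, ← mul_inv, Real.mul_self_sqrt h0.le]
    push_cast; rfl
  have h2 : ∏ p ∈ Finset.Icc 1 n, (p ! : ℂ) =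
      (∏ p ∈ Finset.Icc 1 (n - 1), (p ! : ℂ)) * (n ! : ℂ) := by
    cases n with
    | zero => simp
    | succ m => rw [Finset.prod_Icc_succ_top (by omega)]; rfl
  have h3 : ∏ p ∈ Finset.Icc 1 (n - 1), (p ! : ℂ) ≠ 0 :=
    Finset.prod_ne_zero_iff.2 fun p _ => by exact_mod_cast Nat.factorial_ne_zero p
  rw [h1, h2, mul_inv, mul_right_comm, inv_mul_cancel₀ h3, one_mul]

theorem c_ne_zero (n : ℕ) : c n ≠ 0 := by
  have h0 : 0 < ∏ p ∈ Finset.Icc 1 n, (p ! : ℝ) := Finset.prod_pos fun p _ => by positivity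
  simpa [c] using (Real.sqrt_pos.2 h0).ne'

theorem integral_HCIZ_eq_Q {n : ℕ} (a b : Fin n → ℝ) :
    ∫ u : U n, Complex.exp ((u.1 * Matrix.diagonal (fun i => (a i : ℂ)) * (u⁻¹ : U n).1 *
        Matrix.diagonal (fun i => (b i : ℂ))).trace) ∂(haarU n) =
      Q (Matrix.diagonal fun i => (a i : ℂ)) (Matrix.diagonal fun i => (b i : ℂ)) := by
  refine integral_congr_ae (.of_forall fun u => ?_)
  simp only [cohMat]
  have h : (Matrix.diagonal fun i => (a i : ℂ))ᴴ = Matrix.diagonal fun i => (a i : ℂ) := by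
    rw [Matrix.diagonal_conjTranspose]
    congr 1
    ext i
    simp
  rw [h, mul_assoc, Matrix.trace_mul_comm, ← mul_assoc]

/-- The integral formula is the kernel identity at real, strictly increasing arguments. -/
theorem HCIZ_iff_real (n : ℕ) : HCIZ n ↔ ∀ a b : Fin n → ℝ, StrictMono a → StrictMono b →
    conj (c n * vdm fun i => (a i : ℂ)) * (c n * vdm fun i => (b i : ℂ)) *
      Q (Matrix.diagonal fun i => (a i : ℂ)) (Matrix.diagonal fun i => (b i : ℂ)) =
        R (fun i => (a i : ℂ)) fun i => (b i : ℂ) := by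
  refine forall₄_congr fun a b ha hb => ?_
  have hA := vdm_ne_zero (Complex.ofReal_injective.comp ha.injective)
  have hB := vdm_ne_zero (Complex.ofReal_injective.comp hb.injective)
  simp only [Function.comp_def] at hA hB
  have hc := c_ne_zero n
  rw [integral_HCIZ_eq_Q, R_eq_det, map_mul, conj_c, conj_vdm, ← c_sq_mul]
  simp only [Complex.conj_ofReal]
  rw [eq_div_iff (mul_ne_zero hA hB)]
  constructor
  · intro h
    linear_combination c n * c n * h
  · intro h
    apply mul_left_cancel₀ (mul_ne_zero hc hc)
    linear_combination h

theorem differentiable_vdm {n : ℕ} : Differentiable ℂ (vdm (n := n)) := by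
  unfold vdm
  fun_prop

theorem differentiable_det_exp {n : ℕ} {f : Fin n → Fin n → (Fin n → ℂ) → ℂ}
    (hf : ∀ i j, Differentiable ℂ (f i j)) :
    Differentiable ℂ fun z => (Matrix.of fun i j : Fin n => Complex.exp (f i j z)).det := by
  simp only [Matrix.det_apply, Matrix.of_apply, Units.smul_def, zsmul_eq_mul]
  fun_prop

/-- In terms of `y = conj x` and `z`, both sides are holomorphic: the orbital integral is entire in
each of its two diagonal arguments. So the identity propagates from real to complex arguments, one
argument at a time. -/
theorem kernelIdentity_of_HCIZ {n : ℕ} (h : HCIZ n) : KernelIdentity n := by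
  rw [HCIZ_iff_real] at h
  set I : (Fin n → ℂ) → (Fin n → ℂ) → ℂ := fun y z => ∫ u : U n, Complex.exp
    (((u⁻¹ : U n).1 * Matrix.diagonal z * u.1 * Matrix.diagonal y).trace) ∂(haarU n) with hI
  have hQ : ∀ x z : Fin n → ℂ,
      Q (Matrix.diagonal x) (Matrix.diagonal z) = I (fun i => conj (x i)) z := fun x z => by
    simp only [Q, cohMat, hI, Matrix.diagonal_conjTranspose]
    rfl
  have htr : ∀ (d : Fin n → ℂ) (M : Matrix (Fin n) (Fin n) ℂ),
      (Matrix.diagonal d * M).trace = ∑ i, d i * M i i := fun d M => by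
    simp [Matrix.trace]
  have hdy : ∀ z, Differentiable ℂ fun y => I y z := fun z => by
    simp only [hI]
    simp_rw [Matrix.trace_mul_comm _ (Matrix.diagonal _), htr]
    refine differentiable_integral_exp_haarU (n := n)
      (f := fun u i => ((u⁻¹ : U n).1 * Matrix.diagonal z * u.1) i i) ?_
    exact continuous_pi fun i => ((continuous_inv_U.mul continuous_const).mul
      continuous_val_U).matrix_elem i i
  have hdz : ∀ y, Differentiable ℂ fun z => I y z := fun y => by
    simp only [hI]
    simp_rw [mul_assoc, Matrix.trace_mul_comm (_⁻¹ : U n).1, mul_assoc, htr]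
    refine differentiable_integral_exp_haarU (n := n)
      (f := fun u i => (u.1 * (Matrix.diagonal y * (u⁻¹ : U n).1)) i i) ?_
    exact continuous_pi fun i => (continuous_val_U.mul
      (continuous_const.mul continuous_inv_U)).matrix_elem i i
  set D : (Fin n → ℂ) → (Fin n → ℂ) → ℂ := fun y z =>
    c n * c n * vdm y * vdm z * I y z - (n ! : ℂ)⁻¹ *
      (Matrix.of fun i j : Fin n => Complex.exp (y i * z j)).det with hD
  have hv := differentiable_vdm (n := n)
  have hDy : ∀ z, Differentiable ℂ fun y => D y z := fun z => by
    have h1 := hdy z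
    have h2 := differentiable_det_exp (n := n) (f := fun i j y => y i * z j)
      (fun i j => by fun_prop)
    simp only [hD]
    fun_prop
  have hDz : ∀ y, Differentiable ℂ fun z => D y z := fun y => by
    have h1 := hdz y
    have h2 := differentiable_det_exp (n := n) (f := fun i j z => y i * z j)
      (fun i j => by fun_prop)
    simp only [hD]
    fun_prop
  have hD0 : ∀ y z, D y z = 0 := fun y z => by
    refine eq_zero_of_vanish_strictMono (hDy z) (fun a ha => ?_) y
    refine eq_zero_of_vanish_strictMono (hDz _) (fun b hb => ?_) z
    have := h a b ha hb
    rw [R_eq_det, hQ, map_mul, conj_c, conj_vdm] at this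
    simp only [Complex.conj_ofReal] at this
    simp only [hD]
    linear_combination this
  intro x z
  have := hD0 (fun i => conj (x i)) z
  simp only [hD] at this
  rw [R_eq_det, hQ, map_mul, conj_c, conj_vdm]
  linear_combination this

/-! ### The kernel identity and the unitarity of `ψ` -/

/-- Invariant functions, in the coordinates given by the entries. -/
def invToSpace (n : ℕ) : invSpace n →ₗ[ℂ] space (Fin n × Fin n) where
  toFun F := ⟨fun z => F.1 (toMat z), F.2.1⟩
  map_add' _ _ := rfl
  map_smul' _ _ := rfl

/-- The inclusion of the alternating functions. -/
def altToSpace (n : ℕ) : altSpace n →ₗ[ℂ] space (Fin n) where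
  toFun F := ⟨F.1, F.2.1⟩
  map_add' _ _ := rfl
  map_smul' _ _ := rfl

theorem invToSpace_injective (n : ℕ) : Function.Injective (invToSpace n) := by
  intro F G h
  ext z
  exact congrFun (congrArg Subtype.val h) (entries z)

theorem altToSpace_injective (n : ℕ) : Function.Injective (altToSpace n) := by
  intro F G h
  have h' := congrArg Subtype.val h
  exact Subtype.ext h'

instance completeSpace_inv (n : ℕ) :
    CompleteSpace (LinearMap.range (toL2 ∘ₗ invToSpace n)) := by
  refine completeSpace_range_toL2 _ fun F G h => ?_
  refine ⟨⟨fun z => G.1 (entries z), G.2, fun u z => ?_⟩, rfl⟩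
  refine tendsto_nhds_unique (h (entries z)) ?_
  refine (h (entries ((u⁻¹ : U n).1 * z * u.1))).congr fun k => ?_
  exact ((F k).2.2 u z).symm

instance completeSpace_alt (n : ℕ) :
    CompleteSpace (LinearMap.range (toL2 ∘ₗ altToSpace n)) := by
  refine completeSpace_range_toL2 _ fun F G h => ?_
  refine ⟨⟨G.1, G.2, fun σ z => ?_⟩, rfl⟩
  refine tendsto_nhds_unique (h z) ?_
  refine ((h fun i => z (σ⁻¹ i)).const_mul ((Equiv.Perm.sign σ : ℤ) : ℂ)).congr fun k => ?_
  exact ((F k).2.2 σ z).symm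

/-- The invariant space as a Hilbert space. -/
def invEquiv (n : ℕ) : invSpace n ≃ₗ[ℂ] LinearMap.range (toL2 ∘ₗ invToSpace n) :=
  LinearEquiv.ofInjective _ (toL2_injective.comp (invToSpace_injective n))

/-- The alternating space as a Hilbert space. -/
def altEquiv (n : ℕ) : altSpace n ≃ₗ[ℂ] LinearMap.range (toL2 ∘ₗ altToSpace n) :=
  LinearEquiv.ofInjective _ (toL2_injective.comp (altToSpace_injective n))

theorem inner_invEquiv {n : ℕ} (F G : invSpace n) :
    inner ℂ (invEquiv n F) (invEquiv n G) = innerMat F.1 G.1 :=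
  inner_toL2 (invToSpace n F) (invToSpace n G)

theorem inner_altEquiv {n : ℕ} (F G : altSpace n) :
    inner ℂ (altEquiv n F) (altEquiv n G) = innerProd F.1 G.1 :=
  inner_toL2 (altToSpace n F) (altToSpace n G)

theorem innerMat_smul_left {n : ℕ} (a : ℂ) (F G : Matrix (Fin n) (Fin n) ℂ → ℂ) :
    innerMat (a • F) G = conj a * innerMat F G := by
  simp only [innerMat, innerProd, Pi.smul_apply, smul_eq_mul, map_mul]
  rw [mul_left_comm]
  congr 1
  simp only [mul_assoc]
  rw [integral_const_mul]

/-- If the kernels match, the unitary matching the coherent states of the two spaces is `ψ`, as is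
seen by pairing its values with coherent states. -/
theorem psiUnitary_of_kernelIdentity {n : ℕ} (h : KernelIdentity n) : PsiUnitary n := by
  set q : (Fin n → ℂ) → invSpace n := fun x =>
    conj (c n * vdm x) • ⟨Q (Matrix.diagonal x), Q_mem_invSpace _⟩ with hq
  set r : (Fin n → ℂ) → altSpace n := fun x => ⟨R x, R_mem_altSpace x⟩ with hr
  have hqF : ∀ x (F : invSpace n), inner ℂ (invEquiv n (q x)) (invEquiv n F) =
      c n * vdm x * F.1 (Matrix.diagonal x) := fun x F => by
    rw [inner_invEquiv]
    simp only [hq, Submodule.coe_smul]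
    rw [innerMat_smul_left, Complex.conj_conj, innerMat_Q F.2]
  have hrG : ∀ x (G : altSpace n), inner ℂ (altEquiv n (r x)) (altEquiv n G) = G.1 x :=
    fun x G => by rw [inner_altEquiv]; exact innerProd_R G.2 x
  have hT : ∃ T : LinearMap.range (toL2 ∘ₗ invToSpace n) ≃ₗᵢ[ℂ]
      LinearMap.range (toL2 ∘ₗ altToSpace n), ∀ x, T (invEquiv n (q x)) = altEquiv n (r x) := by
    refine exists_linearIsometryEquiv_of_gram (fun x => invEquiv n (q x))
      (fun x => altEquiv n (r x)) (fun x y => ?_) (fun v hv => ?_) (fun v hv => ?_)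
    · rw [hqF, hrG]
      simp only [hq, hr, Submodule.coe_smul, Pi.smul_apply, smul_eq_mul]
      rw [← h y x]
      ring
    · obtain ⟨F, rfl⟩ := (invEquiv n).surjective v
      simp only [hqF] at hv
      have hd : Differentiable ℂ fun x : Fin n → ℂ => F.1 (Matrix.diagonal x) := by
        have hlin : Differentiable ℂ fun (x : Fin n → ℂ) (p : Fin n × Fin n) =>
            Matrix.diagonal x p.1 p.2 := by
          refine differentiable_pi.2 fun p => ?_
          simp only [Matrix.diagonal_apply]
          split_ifs <;> fun_prop
        exact F.2.1.1.comp hlin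
      have hdiag : ∀ x : Fin n → ℂ, F.1 (Matrix.diagonal x) = 0 := by
        refine eq_zero_of_vanish_strictMono hd fun a ha => ?_
        refine (mul_eq_zero.1 (hv fun i => (a i : ℂ))).resolve_left ?_
        exact mul_ne_zero (c_ne_zero n)
          (vdm_ne_zero (Complex.ofReal_injective.comp ha.injective))
      have hF : F = 0 := by
        ext z
        exact eq_zero_of_vanish_diagonal F.2.1.1 F.2.2 (fun a => hdiag _) z
      rw [hF, map_zero]
    · obtain ⟨G, rfl⟩ := (altEquiv n).surjective v
      simp only [hrG] at hv
      have hG : G = 0 := by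
        ext x
        exact hv x
      rw [hG, map_zero]
  obtain ⟨T, hT⟩ := hT
  have hval : ∀ F : invSpace n, ((altEquiv n).symm (T (invEquiv n F))).1 = psi F.1 := fun F => by
    ext x
    rw [← hrG, LinearEquiv.apply_symm_apply, ← hT, T.inner_map_map, hqF]
    rfl
  refine ⟨(invEquiv n).trans (T.toLinearEquiv.trans (altEquiv n).symm), hval, fun F G => ?_⟩
  rw [← inner_altEquiv, ← inner_invEquiv]
  simp

theorem innerMat_conj_symm {n : ℕ} {F G : Matrix (Fin n) (Fin n) ℂ → ℂ} (hF : F ∈ invSpace n)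
    (hG : G ∈ invSpace n) : conj (innerMat F G) = innerMat G F :=
  innerProd_conj_symm hF.1 hG.1

/-- A unitary `ψ` carries the functional "value at `diag x`" to the functional
"value at `x`", up to the factor `c Δ(x)`; so it matches the coherent states. -/
theorem kernelIdentity_of_psiUnitary {n : ℕ} (h : PsiUnitary n) : KernelIdentity n := by
  obtain ⟨T, hT, hinner⟩ := h
  intro x z
  set G := T.symm ⟨R x, R_mem_altSpace x⟩ with hG
  have hTG : (T G).1 = R x := by rw [hG, LinearEquiv.apply_symm_apply]
  have hval : ∀ a, G.1 a = conj (c n * vdm x) * Q (Matrix.diagonal x) a := fun a => by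
    have hQa := Q_mem_invSpace a
    have hQx := Q_mem_invSpace (Matrix.diagonal x)
    rw [← innerMat_Q G.2 a, ← innerMat_conj_symm G.2 hQa, ← hinner G ⟨Q a, hQa⟩, hTG,
      innerProd_R (T ⟨Q a, hQa⟩).2 x, hT, psi, map_mul, ← innerMat_Q hQx a,
      ← innerMat_conj_symm hQx hQa, innerMat_Q hQa]
  rw [← hTG, hT, psi, hval]
  ring

theorem HCIZ_of_kernelIdentity {n : ℕ} (h : KernelIdentity n) : HCIZ n :=
  (HCIZ_iff_real n).2 fun _ _ _ _ => h _ _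

theorem psi_Q_of_kernelIdentity {n : ℕ} (h : KernelIdentity n) {x : Fin n → ℂ}
    (hx : Function.Injective x) :
    psi (Q (Matrix.diagonal x)) = fun z => R x z / (c n * vdm fun i => conj (x i)) := by
  ext z
  have h1 : (c n * vdm fun i => conj (x i)) ≠ 0 := by
    refine mul_ne_zero (c_ne_zero n) ?_
    rw [← conj_vdm]
    exact (map_ne_zero _).2 (vdm_ne_zero hx)
  rw [psi, eq_div_iff h1, ← h x z, map_mul, conj_c, conj_vdm]
  ring

end SegalBargmann

end

theorem mainTheorem1 (n : ℕ) :
    (SegalBargmann.HCIZ n ↔ SegalBargmann.PsiUnitary n) ∧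
    (SegalBargmann.PsiUnitary n →
      ∀ x : Fin n → ℂ, Function.Injective x →
        SegalBargmann.Q (Matrix.diagonal x) ∈ SegalBargmann.invSpace n ∧
        SegalBargmann.psi (SegalBargmann.Q (Matrix.diagonal x)) =
          fun z => SegalBargmann.R x z /
            (SegalBargmann.c n * SegalBargmann.vdm (fun i => starRingEnd ℂ (x i)))) := by
  refine ⟨⟨fun h => ?_, fun h => ?_⟩, fun h x hx => ⟨SegalBargmann.Q_mem_invSpace _, ?_⟩⟩
  · exact SegalBargmann.psiUnitary_of_kernelIdentity (SegalBargmann.kernelIdentity_of_HCIZ h)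
  · exact SegalBargmann.HCIZ_of_kernelIdentity (SegalBargmann.kernelIdentity_of_psiUnitary h)
  · exact SegalBargmann.psi_Q_of_kernelIdentity
      (SegalBargmann.kernelIdentity_of_psiUnitary h) hx
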